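/- Let $0<\lambda<\mu$ and $\sqrt{\lambda\mu}<\lambda_0<\mu$. For $\rho\in\{\lambda_0,\lambda\}$ let $\pi(\rho)$ be the stationary distribution of the queue-length process of the M/M/1 queue with arrival rate $\rho$ and service rate $\mu$. Let $(X_t)_{t\ge 0}$ be the queue-length process of the M/M/1 queue with arrival rate $\lambda$ and service rate $\mu$, started from $X_0\sim\pi(\lambda_0)$; that is, the Markov process on $\{0,1,2,\dots\}$ with this initial distribution that jumps from $x$ to $x+1$ at rate $\lambda$ and, if $x\ge 1$, from $x$ to $x-1$ at rate $\mu$. Write $\|P-Q\|_{\mathrm{TV}}=\sup_A|P(A)-Q(A)|$. Then there is an explicitly computable constant $C$, depending only on $\lambda_0,\lambda,\mu$, such that for all $t\ge 0$ $$\left\|\mathcal L(X_t)-\pi(\lambda)\right\|_{\mathrm{TV}}\le C\,e^{-\overline\alpha t},\qquad \overline\alpha=\frac{\log\frac{\mu}{\lambda_0}}{\log\sqrt{\frac{\mu}{\lambda}}}\left(\sqrt\mu-\sqrt\lambda\right)^2 .$$ In fact one can take $$C=2+\sqrt{\frac{\lambda}{\mu}}+\Bigl(1-\frac{\lambda_0}{\mu}\Bigr)\frac{\lambda_0}{\lambda_0-\sqrt{\lambda\mu}}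 .$$ -/

import Mathlib

open MeasureTheory
open scoped NNReal

noncomputable section

/-- The generator of the M/M/1 queue-length process with arrival rate `lam` and service rate `mu`:
from every state the queue grows by one at rate `lam`, and from every nonzero state it shrinks
by one at rate `mu`. -/
def mm1Generator (lam mu : ℝ) (f : ℕ → ℝ) (x : ℕ) : ℝ :=
  lam * (f (x + 1) - f x) + if x = 0 then 0 else mu * (f (x - 1) - f x)

/-- The transition probabilities of the M/M/1 queue length, `P_t = exp (t Q)`, where `Q` is
the (bounded) generator: `P_t(x, y) = ∑ n, t ^ n / n! * (Q ^ n 1_{y}) (x)`. -/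
def mm1Transition (lam mu : ℝ) (t : ℝ≥0) (x y : ℕ) : ℝ :=
  ∑' n : ℕ, (t : ℝ) ^ n / (n.factorial : ℝ) * (mm1Generator lam mu)^[n] (Pi.single y 1) x

theorem abs_mm1Generator_le (lam mu : ℝ) (f : ℕ → ℝ) (c : ℝ) (hf : ∀ x, |f x| ≤ c) (x : ℕ) :
    |mm1Generator lam mu f x| ≤ 2 * (|lam| + |mu|) * c := by
  have hc : 0 ≤ c := (abs_nonneg _).trans (hf 0)
  have key : ∀ a y z, |a * (f y - f z)| ≤ 2 * |a| * c := by
    intro a y z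
    rw [abs_mul]
    have h2 : |f y - f z| ≤ 2 * c := by
      have h := abs_sub (f y) (f z)
      linarith [hf y, hf z]
    nlinarith [abs_nonneg a]
  unfold mm1Generator
  refine (abs_add_le _ _).trans ?_
  have h1 := key lam (x + 1) x
  have h2 : |if x = 0 then 0 else mu * (f (x - 1) - f x)| ≤ 2 * |mu| * c := by
    split_ifs
    · simpa using by positivity
    · exact key mu _ _
  linarith

/-- The exponential series defining `mm1Transition` converges. -/
theorem summable_mm1Transition (lam mu : ℝ) (t : ℝ≥0) (x y : ℕ) :
    Summable fun n : ℕ =>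
      (t : ℝ) ^ n / (n.factorial : ℝ) * (mm1Generator lam mu)^[n] (Pi.single y 1) x := by
  have hb : ∀ (n : ℕ) (x : ℕ), |(mm1Generator lam mu)^[n] (Pi.single y 1) x|
      ≤ (2 * (|lam| + |mu|)) ^ n := by
    intro n
    induction n with
    | zero =>
      intro x
      by_cases h : x = y <;> simp [h]
    | succ k ih =>
      intro x
      rw [Function.iterate_succ_apply', pow_succ']
      exact abs_mm1Generator_le lam mu _ _ ih x
  refine Summable.of_norm_bounded
    (Real.summable_pow_div_factorial ((t : ℝ) * (2 * (|lam| + |mu|)))) fun n => ?_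
  rw [norm_mul, Real.norm_eq_abs, Real.norm_eq_abs, abs_of_nonneg (by positivity), mul_pow,
    mul_div_right_comm]
  exact mul_le_mul_of_nonneg_left (hb n x) (by positivity)

/-- `ν` is a stationary distribution of the M/M/1 queue length: `ν P_t = ν` for all `t ≥ 0`. -/
def IsMM1Stationary (lam mu : ℝ) (ν : Measure ℕ) : Prop :=
  IsProbabilityMeasure ν ∧
    ∀ (t : ℝ≥0) (y : ℕ), HasSum (fun x => ν.real {x} * mm1Transition lam mu t x y) (ν.real {y})

/-- `X` is an M/M/1 queue-length process with arrival rate `lam`, service rate `mu` and initial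
distribution `ν`, i.e. a time-homogeneous Markov process on `ℕ` with these transition
probabilities, described through its finite-dimensional distributions. -/
structure IsMM1QueueLength {Ω : Type*} [MeasurableSpace Ω] (P : Measure Ω) (lam mu : ℝ)
    (ν : Measure ℕ) (X : ℝ≥0 → Ω → ℕ) : Prop where
  measurable : ∀ t, Measurable (X t)
  finite_dim : ∀ (n : ℕ) (t : Fin (n + 1) → ℝ≥0) (x : Fin (n + 1) → ℕ),
    Monotone t → t 0 = 0 →
      P.real {ω | ∀ k, X (t k) ω = x k} =
        ν.real {x 0} * ∏ k : Fin n,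
          mm1Transition lam mu (t k.succ - t k.castSucc) (x k.castSucc) (x k.succ)

/-- Total variation distance `sup_A |P(A) - Q(A)|` of two (probability) measures. -/
def tvDist {S : Type*} [MeasurableSpace S] (P Q : Measure S) : ℝ :=
  ⨆ A : {A : Set S // MeasurableSet A}, |P.real A - Q.real A|

/-- The convergence rate `(log (μ/λ₀) / log √(μ/λ)) (√μ - √λ)²`. -/
def mm1Rate (lam₀ lam mu : ℝ) : ℝ :=
  Real.log (mu / lam₀) / Real.log √(mu / lam) * (√mu - √lam) ^ 2

/-- The explicit constant `2 + √(λ/μ) + (1 - λ₀/μ) λ₀ / (λ₀ - √(λμ))`. -/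
def mm1Const (lam₀ lam mu : ℝ) : ℝ :=
  2 + √(lam / mu) + (1 - lam₀ / mu) * (lam₀ / (lam₀ - √(lam * mu)))

end

/-!
The proof couples two copies of the queue by letting them jump up together and down together, a
departure from an empty queue being a void jump. They meet at the latest when the larger copy
empties. Since `θ ^ x`, with `θ = √(mu / lam)`, is an eigenfunction of the generator at `x ≥ 1` for
the eigenvalue `-(√mu - √lam)²`, copies started from `x` and `y` are still apart at time `t` with
probability at most `min 1 (θ ^ max x y * e^{-(√mu - √lam)² t})`.

No coupled process is constructed. By uniformization (`hasSum_mm1Transition`),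
`exp (t Q) = e^{-(lam + mu) t} exp (t L)` with the jump operator
`L f x = lam * f (x + 1) + mu * f (x - 1)`, and the coupling becomes an induction on `n` for
`L ^ n f x - L ^ n f y` (`abs_mm1Jump_pow_sub_le`).

Differentiating the stationarity equation at `t = 0` gives the balance equations, hence the
stationary distributions are geometric (`IsMM1Stationary.real_singleton`). Taking `x` and `y`
independent with distributions `π₀` and `π` bounds the total variation distance by
`E_{π₀} min 1 (θ ^ x e^{-(√mu - √lam)² t}) + E_π θ ^ y e^{-(√mu - √lam)² t}`
(`abs_sub_le_of_abs_sub_le_add`). The second mean is `(1 + √(lam / mu)) e^{-(√mu - √lam)² t}`. The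
first is computed in `exists_hasSum_geometric_mul_min`: `θ ^ x` is not integrable under `π₀`, and
truncating it at `1` is what lowers the rate to `mm1Rate`.
-/

/-! ### Uniformization -/

/-- The jump operator `f ↦ lam * f (x + 1) + mu * f (x - 1)` of the M/M/1 queue, in which a
departure from the empty queue is a jump `0 → 0` (truncated subtraction). The generator is this
operator minus `lam + mu`. -/
def mm1Jump (lam mu : ℝ) : Module.End ℝ (ℕ → ℝ) where
  toFun f x := lam * f (x + 1) + mu * f (x - 1)
  map_add' f g := by ext x; simp only [Pi.add_apply]; ring
  map_smul' c f := by ext x; simp only [Pi.smul_apply, smul_eq_mul, RingHom.id_apply]; ring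

theorem mm1Jump_apply (lam mu : ℝ) (f : ℕ → ℝ) (x : ℕ) :
    mm1Jump lam mu f x = lam * f (x + 1) + mu * f (x - 1) := rfl

theorem mm1Jump_pow_succ_apply (lam mu : ℝ) (n : ℕ) (f : ℕ → ℝ) (x : ℕ) :
    (mm1Jump lam mu ^ (n + 1)) f x =
      lam * (mm1Jump lam mu ^ n) f (x + 1) + mu * (mm1Jump lam mu ^ n) f (x - 1) := by
  rw [pow_succ', Module.End.mul_apply, mm1Jump_apply]

theorem mm1Generator_eq (lam mu : ℝ) :
    mm1Generator lam mu = ⇑(mm1Jump lam mu + algebraMap ℝ _ (-(lam + mu))) := by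
  ext f x
  rw [LinearMap.add_apply, Pi.add_apply, mm1Jump_apply, Module.algebraMap_end_apply, Pi.smul_apply,
    smul_eq_mul, mm1Generator]
  split_ifs with h
  · subst h; simp only [zero_add, zero_tsub]; ring
  · ring

theorem abs_mm1Jump_pow_le {lam mu : ℝ} (hlam : 0 ≤ lam) (hmu : 0 ≤ mu) {f : ℕ → ℝ} {c : ℝ}
    (hf : ∀ x, |f x| ≤ c) (n x : ℕ) : |(mm1Jump lam mu ^ n) f x| ≤ (lam + mu) ^ n * c := by
  induction n generalizing x with
  | zero => simpa using hf x
  | succ n ih =>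
    rw [mm1Jump_pow_succ_apply]
    refine (abs_add_le _ _).trans ?_
    rw [abs_mul, abs_mul, abs_of_nonneg hlam, abs_of_nonneg hmu, pow_succ']
    nlinarith [mul_le_mul_of_nonneg_left (ih (x + 1)) hlam,
      mul_le_mul_of_nonneg_left (ih (x - 1)) hmu]

theorem summable_mm1Jump {lam mu : ℝ} (hlam : 0 ≤ lam) (hmu : 0 ≤ mu) {f : ℕ → ℝ} {c : ℝ}
    (hf : ∀ x, |f x| ≤ c) (t : ℝ≥0) (x : ℕ) :
    Summable fun n : ℕ => ‖(t : ℝ) ^ n / n.factorial * (mm1Jump lam mu ^ n) f x‖ := by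
  refine Summable.of_nonneg_of_le (fun _ => norm_nonneg _) (fun n => ?_)
    ((Real.summable_pow_div_factorial ((t : ℝ) * (lam + mu))).mul_right c)
  rw [norm_mul, Real.norm_eq_abs, Real.norm_eq_abs, abs_of_nonneg (by positivity), mul_pow,
    mul_div_right_comm, mul_assoc]
  exact mul_le_mul_of_nonneg_left (abs_mm1Jump_pow_le hlam hmu hf n x) (by positivity)

/-- Uniformization: `exp (t Q) = e^{-(lam + mu) t} exp (t L)`, where `L` is the jump operator. -/
theorem hasSum_mm1Transition {lam mu : ℝ} (hlam : 0 ≤ lam) (hmu : 0 ≤ mu) (t : ℝ≥0) (x y : ℕ) :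
    HasSum (fun n : ℕ => Real.exp (-(lam + mu) * t) *
      ((t : ℝ) ^ n / n.factorial * (mm1Jump lam mu ^ n) (Pi.single y 1) x))
      (mm1Transition lam mu t x y) := by
  have hf : ∀ z, |(Pi.single y 1 : ℕ → ℝ) z| ≤ 1 := fun z => by
    by_cases h : z = y <;> simp [h]
  have h1 := summable_mm1Jump hlam hmu hf t x
  have h2 : Summable fun n : ℕ => ‖(-(lam + mu) * (t : ℝ)) ^ n / n.factorial‖ :=
    (Real.summable_pow_div_factorial _).norm
  have h3 := tsum_mul_tsum_eq_tsum_sum_antidiagonal_of_summable_norm h1 h2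
  have h4 : Real.exp (-(lam + mu) * t) = ∑' n : ℕ, (-(lam + mu) * (t : ℝ)) ^ n / n.factorial := by
    rw [Real.exp_eq_exp_ℝ, NormedSpace.exp_eq_tsum_div]
  have key : mm1Transition lam mu t x y = Real.exp (-(lam + mu) * t) *
      ∑' n : ℕ, (t : ℝ) ^ n / n.factorial * (mm1Jump lam mu ^ n) (Pi.single y 1) x := by
    rw [mul_comm, h4, h3, mm1Transition]
    refine tsum_congr fun n => ?_
    rw [mm1Generator_eq, ← Module.End.coe_pow,
      (Algebra.commute_algebraMap_right (-(lam + mu)) (mm1Jump lam mu)).add_pow',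
      LinearMap.sum_apply, Finset.sum_apply, Finset.mul_sum]
    refine Finset.sum_congr rfl fun p hp => ?_
    rw [← map_pow, LinearMap.smul_apply, ← Algebra.commutes, Module.End.mul_apply,
      Module.algebraMap_end_apply, Pi.smul_apply, Pi.smul_apply, smul_eq_mul, nsmul_eq_mul]
    obtain rfl := Finset.HasAntidiagonal.mem_antidiagonal.mp hp
    have h5 : ((p.1 + p.2).choose p.1 : ℝ) * p.1.factorial * p.2.factorial =
        (p.1 + p.2).factorial := by
      rw [Nat.choose_symm_add]
      exact_mod_cast Nat.add_choose_mul_factorial_mul_factorial p.1 p.2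
    rw [← h5, pow_add, mul_pow]
    have h6 : ((p.1 + p.2).choose p.1 : ℝ) ≠ 0 := by
      exact_mod_cast (Nat.choose_pos (Nat.le_add_right _ _)).ne'
    field_simp
  rw [key]
  exact h1.of_norm.hasSum.mul_left _

/-! ### Synchronous coupling -/

/-- The synchronous coupling of two jump chains: they jump up together and down together, and once
they meet they stay together. The larger chain is positive until they meet, and at a positive `x`
the function `√(mu / lam) ^ x` is multiplied by `2 * √(lam * mu)` in each step. -/
theorem abs_mm1Jump_pow_sub_le {lam mu : ℝ} (hlam : 0 < lam) (hmu : 0 < mu) {f : ℕ → ℝ}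
    (hf : ∀ x y, |f x - f y| ≤ 1) (hle : lam ≤ mu) (n : ℕ) {x y : ℕ} (hyx : y ≤ x) :
    |(mm1Jump lam mu ^ n) f x - (mm1Jump lam mu ^ n) f y| ≤
      (2 * √(lam * mu)) ^ n * √(mu / lam) ^ x := by
  have hθ : 1 ≤ √(mu / lam) := Real.one_le_sqrt.mpr ((one_le_div hlam).mpr hle)
  have hup : lam * √(mu / lam) = √(lam * mu) := by
    rw [Real.sqrt_div hmu.le, Real.sqrt_mul hlam.le]
    nth_rw 1 [← Real.mul_self_sqrt hlam.le]
    have := (Real.sqrt_pos.mpr hlam).ne'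
    field_simp
  have hdown : mu = √(lam * mu) * √(mu / lam) := by
    rw [← Real.sqrt_mul (by positivity), show lam * mu * (mu / lam) = mu * mu by field_simp,
      Real.sqrt_mul_self hmu.le]
  induction n generalizing x y with
  | zero => simpa using (hf x y).trans (one_le_pow₀ hθ)
  | succ n ih =>
    rcases hyx.eq_or_lt with rfl | hlt
    · simp only [sub_self, abs_zero]; positivity
    obtain ⟨k, rfl⟩ : ∃ k, x = k + 1 := ⟨x - 1, by omega⟩
    have i1 := mul_le_mul_of_nonneg_left (ih (x := k + 1 + 1) (y := y + 1) (by omega)) hlam.le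
    have i2 := mul_le_mul_of_nonneg_left (ih (x := k + 1 - 1) (y := y - 1) (by omega)) hmu.le
    rw [mm1Jump_pow_succ_apply, mm1Jump_pow_succ_apply]
    calc _ = |lam * ((mm1Jump lam mu ^ n) f (k + 1 + 1) - (mm1Jump lam mu ^ n) f (y + 1)) +
          mu * ((mm1Jump lam mu ^ n) f (k + 1 - 1) - (mm1Jump lam mu ^ n) f (y - 1))| := by
          congr 1; ring
      _ ≤ lam * ((2 * √(lam * mu)) ^ n * √(mu / lam) ^ (k + 1 + 1)) +
          mu * ((2 * √(lam * mu)) ^ n * √(mu / lam) ^ (k + 1 - 1)) := by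
          refine (abs_add_le _ _).trans ?_
          rw [abs_mul, abs_mul, abs_of_pos hlam, abs_of_pos hmu]
          exact add_le_add i1 i2
      _ = (lam * √(mu / lam)) * ((2 * √(lam * mu)) ^ n * √(mu / lam) ^ (k + 1)) +
          mu * ((2 * √(lam * mu)) ^ n * √(mu / lam) ^ k) := by
          rw [Nat.add_sub_cancel]; ring
      _ = _ := by
          rw [hup, congrArg (· * ((2 * √(lam * mu)) ^ n * √(mu / lam) ^ k)) hdown]; ring

theorem abs_mm1Jump_pow_sub_le_add_pow {lam mu : ℝ} (hlam : 0 ≤ lam) (hmu : 0 ≤ mu) {f : ℕ → ℝ}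
    (hf : ∀ x y, |f x - f y| ≤ 1) (n x y : ℕ) :
    |(mm1Jump lam mu ^ n) f x - (mm1Jump lam mu ^ n) f y| ≤ (lam + mu) ^ n := by
  induction n generalizing x y with
  | zero => simpa using hf x y
  | succ n ih =>
    rw [mm1Jump_pow_succ_apply, mm1Jump_pow_succ_apply]
    calc _ = |lam * ((mm1Jump lam mu ^ n) f (x + 1) - (mm1Jump lam mu ^ n) f (y + 1)) +
          mu * ((mm1Jump lam mu ^ n) f (x - 1) - (mm1Jump lam mu ^ n) f (y - 1))| := by
          congr 1; ring
      _ ≤ lam * (lam + mu) ^ n + mu * (lam + mu) ^ n := by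
          refine (abs_add_le _ _).trans ?_
          rw [abs_mul, abs_mul, abs_of_nonneg hlam, abs_of_nonneg hmu]
          exact add_le_add (mul_le_mul_of_nonneg_left (ih _ _) hlam)
            (mul_le_mul_of_nonneg_left (ih _ _) hmu)
      _ = _ := by ring

/-- Bounds on the jump chain, uniform in the number of steps up to a factor `a ^ n`, pass to the
queue through uniformization. -/
theorem abs_sum_mm1Transition_sub_le {lam mu : ℝ} (hlam : 0 ≤ lam) (hmu : 0 ≤ mu) (t : ℝ≥0)
    (A : Finset ℕ) {x y : ℕ} {a b : ℝ}
    (h : ∀ n, |(mm1Jump lam mu ^ n) (∑ z ∈ A, Pi.single z 1) x -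
      (mm1Jump lam mu ^ n) (∑ z ∈ A, Pi.single z 1) y| ≤ a ^ n * b) :
    |∑ z ∈ A, mm1Transition lam mu t x z - ∑ z ∈ A, mm1Transition lam mu t y z| ≤
      Real.exp (-(lam + mu - a) * t) * b := by
  have hs : ∀ w, HasSum (fun n : ℕ => Real.exp (-(lam + mu) * t) *
      ((t : ℝ) ^ n / n.factorial * (mm1Jump lam mu ^ n) (∑ z ∈ A, Pi.single z 1) w))
      (∑ z ∈ A, mm1Transition lam mu t w z) := fun w => by
    convert hasSum_sum fun z (_ : z ∈ A) => hasSum_mm1Transition hlam hmu t w z using 1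
    ext n
    rw [map_sum, Finset.sum_apply, Finset.mul_sum, Finset.mul_sum]
  have hd := (hs x).sub (hs y)
  have he : HasSum (fun n : ℕ => Real.exp (-(lam + mu) * t) *
      ((a * (t : ℝ)) ^ n / n.factorial * b)) (Real.exp (-(lam + mu - a) * t) * b) := by
    have h4 : HasSum (fun n : ℕ => (a * (t : ℝ)) ^ n / n.factorial) (Real.exp (a * t)) := by
      rw [Real.exp_eq_exp_ℝ]; exact NormedSpace.expSeries_div_hasSum_exp _
    rw [show -(lam + mu - a) * (t : ℝ) = -(lam + mu) * t + a * t by ring, Real.exp_add, mul_assoc]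
    exact (h4.mul_right b).mul_left _
  rw [← hd.tsum_eq, ← he.tsum_eq, ← Real.norm_eq_abs]
  refine tsum_of_norm_bounded he.summable.hasSum fun n => ?_
  rw [← mul_sub, ← mul_sub, norm_mul, norm_mul, Real.norm_eq_abs, Real.norm_eq_abs,
    Real.norm_eq_abs, abs_of_pos (Real.exp_pos _), abs_of_nonneg (by positivity), mul_pow]
  calc _ ≤ Real.exp (-(lam + mu) * t) * ((t : ℝ) ^ n / n.factorial * (a ^ n * b)) := by
        gcongr; exact h n
    _ = _ := by ring

theorem abs_sum_single_sub_le (A : Finset ℕ) (x y : ℕ) :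
    |(∑ z ∈ A, Pi.single z 1 : ℕ → ℝ) x - (∑ z ∈ A, Pi.single z 1 : ℕ → ℝ) y| ≤ 1 := by
  have h : ∀ w, (∑ z ∈ A, Pi.single z 1 : ℕ → ℝ) w = if w ∈ A then 1 else 0 := fun w => by
    simp [Finset.sum_apply, Pi.single_apply]
  rw [h, h]
  split_ifs <;> simp

theorem abs_sum_mm1Transition_sub_le_one {lam mu : ℝ} (hlam : 0 ≤ lam) (hmu : 0 ≤ mu) (t : ℝ≥0)
    (A : Finset ℕ) (x y : ℕ) :
    |∑ z ∈ A, mm1Transition lam mu t x z - ∑ z ∈ A, mm1Transition lam mu t y z| ≤ 1 := by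
  have := abs_sum_mm1Transition_sub_le hlam hmu t A (x := x) (y := y) (a := lam + mu) (b := 1)
    fun n => by
      simpa using abs_mm1Jump_pow_sub_le_add_pow hlam hmu (abs_sum_single_sub_le A) n x y
  simpa using this

theorem add_sub_two_mul_sqrt {lam mu : ℝ} (hlam : 0 ≤ lam) (hmu : 0 ≤ mu) :
    lam + mu - 2 * √(lam * mu) = (√mu - √lam) ^ 2 := by
  rw [Real.sqrt_mul hlam, sub_sq, Real.sq_sqrt hlam, Real.sq_sqrt hmu]; ring

/-- The two queues have met once the larger one has emptied, which fails by time `t` with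
probability at most `√(mu / lam) ^ max x y * e^{-(√mu - √lam)² t}`. -/
theorem abs_sum_mm1Transition_sub_le_exp {lam mu : ℝ} (hlam : 0 < lam) (hle : lam ≤ mu) (t : ℝ≥0)
    (A : Finset ℕ) (x y : ℕ) :
    |∑ z ∈ A, mm1Transition lam mu t x z - ∑ z ∈ A, mm1Transition lam mu t y z| ≤
      Real.exp (-(√mu - √lam) ^ 2 * t) * √(mu / lam) ^ max x y := by
  have hmu := hlam.trans_le hle
  wlog hyx : y ≤ x generalizing x y
  · rw [abs_sub_comm, max_comm]; exact this y x (le_of_not_ge hyx)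
  rw [max_eq_left hyx, ← add_sub_two_mul_sqrt hlam.le hmu.le]
  exact abs_sum_mm1Transition_sub_le hlam.le hmu.le t A fun n =>
    abs_mm1Jump_pow_sub_le hlam hmu (abs_sum_single_sub_le A) hle n hyx

/-! ### The stationary distribution -/

theorem abs_iterate_mm1Generator_le (lam mu : ℝ) (y n x : ℕ) :
    |(mm1Generator lam mu)^[n] (Pi.single y 1) x| ≤ (2 * (|lam| + |mu|)) ^ n := by
  induction n generalizing x with
  | zero => by_cases h : x = y <;> simp [h]
  | succ k ih =>
    rw [Function.iterate_succ_apply', pow_succ']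
    exact abs_mm1Generator_le lam mu _ _ ih x

/-- First-order expansion of `P_t` at `t = 0`, uniform in the starting point `x`. -/
theorem abs_mm1Transition_sub_le (lam mu : ℝ) (t : ℝ≥0) (x y : ℕ)
    (ht : t * (2 * (|lam| + |mu|)) ≤ 1) :
    |mm1Transition lam mu t x y - (Pi.single y 1 : ℕ → ℝ) x -
      t * mm1Generator lam mu (Pi.single y 1) x| ≤ (t * (2 * (|lam| + |mu|))) ^ 2 := by
  set M := 2 * (|lam| + |mu|) with hM
  have h1 := (summable_mm1Transition lam mu t x y).sum_add_tsum_nat_add 2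
  have h2 := (Real.summable_pow_div_factorial (t * M)).sum_add_tsum_nat_add 2
  have h0 : 0 ≤ t * M := by positivity
  have h3 : ∑' n : ℕ, (t * M) ^ n / n.factorial = Real.exp (t * M) := by
    rw [Real.exp_eq_exp_ℝ, NormedSpace.exp_eq_tsum_div]
  rw [h3] at h2
  have h4 := Real.abs_exp_sub_one_sub_id_le (x := t * M) (by rwa [abs_of_nonneg h0])
  simp only [Finset.sum_range_succ, Finset.sum_range_zero] at h1 h2
  simp only [pow_zero, Nat.factorial_zero, Nat.cast_one, div_one, Function.iterate_zero, id,
    pow_one, Nat.factorial_one, Function.iterate_one, one_mul, zero_add] at h1 h2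
  rw [mm1Transition, ← h1]
  refine le_trans ?_ ((le_abs_self _).trans h4)
  rw [← h2]
  have hs := (summable_nat_add_iff 2).mpr (Real.summable_pow_div_factorial (t * M))
  have := tsum_of_norm_bounded hs.hasSum (f := fun n : ℕ => (t : ℝ) ^ (n + 2) /
    ((n + 2).factorial : ℝ) * (mm1Generator lam mu)^[n + 2] (Pi.single y 1) x) fun n => by
      rw [norm_mul, Real.norm_eq_abs, Real.norm_eq_abs, abs_of_nonneg (by positivity), mul_pow,
        mul_div_right_comm]
      exact mul_le_mul_of_nonneg_left (abs_iterate_mm1Generator_le lam mu y (n + 2) x)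
        (by positivity)
  rw [Real.norm_eq_abs] at this
  rwa [sub_sub, add_sub_cancel_left, sub_sub, add_sub_cancel_left]

theorem hasSum_real_inter_preimage_singleton {Ω : Type*} [MeasurableSpace Ω] (P : Measure Ω)
    [IsFiniteMeasure P] {Y : Ω → ℕ} (hY : Measurable Y) {E : Set Ω} (hE : MeasurableSet E) :
    HasSum (fun n => P.real (E ∩ Y ⁻¹' {n})) (P.real E) := by
  have h := measure_iUnion (μ := P) (f := fun n => E ∩ Y ⁻¹' {n})
    (fun m n hmn => Set.disjoint_left.mpr fun ω h1 h2 => hmn (h1.2.symm.trans h2.2))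
    fun n => hE.inter (hY (measurableSet_singleton n))
  rw [← Set.inter_iUnion, ← Set.preimage_iUnion, Set.iUnion_of_singleton, Set.preimage_univ,
    Set.inter_univ] at h
  rw [Measure.real, h, ENNReal.tsum_toReal_eq fun n => measure_ne_top P _]
  exact ENNReal.hasSum_toReal (h ▸ measure_ne_top P E)

theorem hasSum_real_singleton (ν : Measure ℕ) [IsProbabilityMeasure ν] :
    HasSum (fun x => ν.real {x}) 1 := by
  simpa using hasSum_real_inter_preimage_singleton ν measurable_id MeasurableSet.univ

/-- The balance equations `ν Q = 0`, as the derivative of `ν P_t = ν` at `t = 0`. -/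
theorem IsMM1Stationary.hasSum_generator {lam mu : ℝ} {ν : Measure ℕ}
    (h : IsMM1Stationary lam mu ν) (y : ℕ) :
    HasSum (fun x => ν.real {x} * mm1Generator lam mu (Pi.single y 1) x) 0 := by
  have := h.1
  have h1 := hasSum_real_singleton ν
  set M := 2 * (|lam| + |mu|) with hM
  have hM0 : 0 ≤ M := by positivity
  have hs : Summable fun x => ν.real {x} * mm1Generator lam mu (Pi.single y 1) x := by
    refine Summable.of_norm_bounded (h1.summable.mul_right M) fun x => ?_
    rw [norm_mul, Real.norm_eq_abs, Real.norm_eq_abs, abs_of_nonneg measureReal_nonneg]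
    exact mul_le_mul_of_nonneg_left (by simpa using abs_iterate_mm1Generator_le lam mu y 1 x)
      measureReal_nonneg
  obtain ⟨b, hb⟩ := hs
  have hsingle : HasSum (fun x => ν.real {x} * (Pi.single y 1 : ℕ → ℝ) x) (ν.real {y}) := by
    convert hasSum_single (f := fun x => ν.real {x} * (Pi.single y 1 : ℕ → ℝ) x) y
      (fun x hx => by simp [hx]) using 1
    simp
  have hbound : ∀ t : ℝ≥0, t * M ≤ 1 → t * |b| ≤ (t * M) ^ 2 := fun t ht => by
    have hd := ((h.2 t y).sub hsingle).sub (hb.mul_left (t : ℝ))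
    have := tsum_of_norm_bounded (h1.mul_right ((t * M) ^ 2)) (f := fun x =>
      ν.real {x} * mm1Transition lam mu t x y - ν.real {x} * (Pi.single y 1 : ℕ → ℝ) x -
        t * (ν.real {x} * mm1Generator lam mu (Pi.single y 1) x)) fun x => by
      have := mul_le_mul_of_nonneg_left (abs_mm1Transition_sub_le lam mu t x y ht)
        (measureReal_nonneg (μ := ν) (s := {x}))
      refine le_trans (le_of_eq ?_) this
      rw [Real.norm_eq_abs, ← abs_of_nonneg (measureReal_nonneg (μ := ν) (s := {x})), ← abs_mul,
        abs_of_nonneg (measureReal_nonneg (μ := ν) (s := {x}))]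
      congr 1; ring
    rw [hd.tsum_eq] at this
    simpa [abs_mul] using this
  have hb0 : |b| ≤ 0 := by
    refine le_of_forall_pos_le_add fun ε hε => ?_
    set t : ℝ := min (1 / (M + 1)) (ε / (M + 1) ^ 2) with ht
    have htpos : 0 < t := by positivity
    have ht1 : t * (M + 1) ≤ 1 := by
      rw [← le_div_iff₀ (by positivity)]; exact min_le_left _ _
    have ht2 : t * (M + 1) ^ 2 ≤ ε := by
      rw [← le_div_iff₀ (by positivity)]; exact min_le_right _ _
    have := hbound ⟨t, htpos.le⟩ (by show t * M ≤ 1; nlinarith)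
    change t * |b| ≤ (t * M) ^ 2 at this
    have : |b| ≤ t * M ^ 2 := by
      rw [mul_pow, sq, mul_assoc] at this
      exact le_of_mul_le_mul_left this htpos
    nlinarith
  rwa [abs_nonpos_iff.mp hb0] at hb

/-- Detailed balance between neighbouring states, by induction from the balance equations. -/
theorem IsMM1Stationary.real_singleton_succ {lam mu : ℝ} (hmu : mu ≠ 0) {ν : Measure ℕ}
    (h : IsMM1Stationary lam mu ν) (n : ℕ) : ν.real {n + 1} = lam / mu * ν.real {n} := by
  suffices mu * ν.real {n + 1} = lam * ν.real {n} by field_simp; linarith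
  induction n with
  | zero =>
    have h1 := (h.hasSum_generator 0).unique
      (hasSum_sum_of_ne_finset_zero (s := {0, 1}) fun x hx => ?_)
    · rw [Finset.sum_pair (by simp)] at h1
      simp [mm1Generator] at h1
      simp
      linarith
    · have : x ≠ 0 ∧ x ≠ 1 := by simpa using hx
      simp [mm1Generator, this.1, show x - 1 ≠ 0 by omega]
  | succ n ih =>
    have h1 := (h.hasSum_generator (n + 1)).unique
      (hasSum_sum_of_ne_finset_zero (s := {n, n + 1, n + 2}) fun x hx => ?_)
    · rw [Finset.sum_insert (by simp), Finset.sum_pair (by simp)] at h1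
      simp [mm1Generator, show n - 1 ≠ n + 1 by omega] at h1
      rw [show n + 1 + 1 = n + 2 from rfl]
      linarith
    · have : x ≠ n ∧ x ≠ n + 1 ∧ x ≠ n + 2 := by simpa using hx
      simp [mm1Generator, this.1, this.2.1, show x - 1 ≠ n + 1 by omega]

/-- The stationary distribution is geometric with ratio `lam / mu`. -/
theorem IsMM1Stationary.real_singleton {lam mu : ℝ} (hlam : 0 ≤ lam) (hlt : lam < mu)
    {ν : Measure ℕ} (h : IsMM1Stationary lam mu ν) (n : ℕ) :
    ν.real {n} = (1 - lam / mu) * (lam / mu) ^ n := by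
  have := h.1
  have hmu : 0 < mu := hlam.trans_lt hlt
  have h1 : ∀ n, ν.real {n} = ν.real {0} * (lam / mu) ^ n := fun n => by
    induction n with
    | zero => simp
    | succ n ih => rw [h.real_singleton_succ hmu.ne', ih]; ring
  have h2 := (hasSum_geometric_of_lt_one (div_nonneg hlam hmu.le)
    ((div_lt_one hmu).mpr hlt)).mul_left (ν.real {0})
  simp only [← h1] at h2
  have h3 := h2.unique (hasSum_real_singleton ν)
  have h4 : 0 < 1 - lam / mu := sub_pos.mpr ((div_lt_one hmu).mpr hlt)
  rw [h1, show ν.real {0} = 1 - lam / mu by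
    rwa [← div_eq_mul_inv, div_eq_one_iff_eq h4.ne'] at h3]

/-! ### Total variation and the law of the queue length -/

/-- The total variation distance of finite measures on `ℕ` is the supremum over finite sets. -/
theorem tvDist_le_of_finset {P Q : Measure ℕ} [IsFiniteMeasure P] [IsFiniteMeasure Q] {c : ℝ}
    (h : ∀ A : Finset ℕ, |P.real A - Q.real A| ≤ c) : tvDist P Q ≤ c := by
  classical
  refine ciSup_le fun ⟨A, hA⟩ => ?_
  have h1 := (hasSum_real_inter_preimage_singleton P measurable_id hA).sub
    (hasSum_real_inter_preimage_singleton Q measurable_id hA)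
  refine le_of_tendsto' (Filter.Tendsto.abs h1) fun s => ?_
  have h2 : ∀ (R : Measure ℕ) [IsFiniteMeasure R],
      ∑ n ∈ s, R.real (A ∩ id ⁻¹' {n}) = R.real ↑(s.filter (· ∈ A)) := fun R _ => by
    rw [← sum_measureReal_singleton, Finset.sum_filter]
    refine Finset.sum_congr rfl fun n _ => ?_
    split_ifs with hn
    · congr 1; ext x; simp only [Set.preimage_id, Set.mem_inter_iff, Set.mem_singleton_iff]
      exact ⟨fun h => h.2, fun h => ⟨h ▸ hn, h⟩⟩
    · rw [show A ∩ id ⁻¹' {n} = ∅ by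
        ext x; simp only [Set.preimage_id, Set.mem_inter_iff, Set.mem_singleton_iff,
          Set.mem_empty_iff_false, iff_false]
        rintro ⟨h, rfl⟩; exact hn h, measureReal_empty]
  rw [Finset.sum_sub_distrib, h2 P, h2 Q]
  exact h _

theorem IsMM1QueueLength.hasSum_real_map {Ω : Type*} [MeasurableSpace Ω] {P : Measure Ω}
    [IsFiniteMeasure P] {lam mu : ℝ} {ν : Measure ℕ} {X : ℝ≥0 → Ω → ℕ}
    (hX : IsMM1QueueLength P lam mu ν X) (t : ℝ≥0) (A : Finset ℕ) :
    HasSum (fun x => ν.real {x} * ∑ y ∈ A, mm1Transition lam mu t x y)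
      ((P.map (X t)).real A) := by
  rw [← sum_measureReal_singleton]
  simp only [Finset.mul_sum]
  refine hasSum_sum fun y _ => ?_
  rw [map_measureReal_apply (hX.measurable t) (measurableSet_singleton y)]
  convert hasSum_real_inter_preimage_singleton P (hX.measurable 0)
    (hX.measurable t (measurableSet_singleton y)) using 1
  ext x
  have h := hX.finite_dim 1 ![0, t] ![x, y] (by
    intro i j hij
    fin_cases i <;> fin_cases j <;> simp_all) rfl
  simp only [Finset.univ_unique, Finset.prod_singleton] at h
  simp at h
  rw [← h]
  congr 1; ext ω; simp [and_comm]

theorem IsMM1Stationary.hasSum_real {lam mu : ℝ} {ν : Measure ℕ} (h : IsMM1Stationary lam mu ν)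
    (t : ℝ≥0) (A : Finset ℕ) :
    HasSum (fun x => ν.real {x} * ∑ y ∈ A, mm1Transition lam mu t x y) (ν.real A) := by
  have := h.1
  rw [← sum_measureReal_singleton]
  simp only [Finset.mul_sum]
  exact hasSum_sum fun y _ => h.2 t y

/-! ### Comparison of means -/

theorem hasSum_le_of_sub_le_add {p q a b g : ℕ → ℝ} {Ea Eb G₀ G₁ : ℝ} (hp : ∀ x, 0 ≤ p x)
    (hq : ∀ x, 0 ≤ q x) (hp1 : HasSum p 1) (hq1 : HasSum q 1)
    (ha : HasSum (fun x => p x * a x) Ea) (hb : HasSum (fun x => q x * b x) Eb)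
    (h₀ : HasSum (fun x => p x * g x) G₀) (h₁ : HasSum (fun x => q x * g x) G₁)
    (h : ∀ x y, g x - g y ≤ a x + b y) : G₀ - G₁ ≤ Ea + Eb := by
  have h2 : ∀ y, G₀ ≤ Ea + 1 * (g y + b y) := fun y =>
    hasSum_le (fun x => by nlinarith [hp x, h x y]) h₀ (ha.add (hp1.mul_right _))
  have h3 : 1 * (G₀ - Ea) ≤ G₁ + Eb :=
    hasSum_le (fun y => by nlinarith [hq y, h2 y]) (hq1.mul_right (G₀ - Ea)) (h₁.add hb)
  linarith

/-- If `g x - g y` is bounded by `a x + b y`, then the means of `g` under two distributions differ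
by at most the sum of the means of `a` and `b`: take the two distributions independent. -/
theorem abs_sub_le_of_abs_sub_le_add {p q a b g : ℕ → ℝ} {Ea Eb G₀ G₁ : ℝ} (hp : ∀ x, 0 ≤ p x)
    (hq : ∀ x, 0 ≤ q x) (hp1 : HasSum p 1) (hq1 : HasSum q 1)
    (ha : HasSum (fun x => p x * a x) Ea) (hb : HasSum (fun x => q x * b x) Eb)
    (h₀ : HasSum (fun x => p x * g x) G₀) (h₁ : HasSum (fun x => q x * g x) G₁)
    (h : ∀ x y, |g x - g y| ≤ a x + b y) : |G₀ - G₁| ≤ Ea + Eb := by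
  refine abs_le'.mpr ⟨hasSum_le_of_sub_le_add hp hq hp1 hq1 ha hb h₀ h₁
    fun x y => (le_abs_self _).trans (h x y), ?_⟩
  have := hasSum_le_of_sub_le_add (g := fun x => -g x) hp hq hp1 hq1 ha hb
    (by simpa using h₀.neg) (by simpa using h₁.neg)
    fun x y => by linarith [neg_abs_le (g x - g y), h x y]
  linarith

/-- The mean of `min 1 (e^{-c} θ ^ x)` under the geometric distribution with ratio `σ`: the two
bounds cross at `x = c / log θ`, and beyond this point the distribution has mass about
`e^{-(c / log θ) log (1 / σ)}`. -/
theorem exists_hasSum_geometric_mul_min {σ θ c : ℝ} (hσ1 : σ < 1) (hθ : 1 < θ) (hσθ : 1 < σ * θ)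
    (hc : 0 ≤ c) :
    ∃ S, HasSum (fun x : ℕ => (1 - σ) * σ ^ x * min 1 (Real.exp (-c) * θ ^ x)) S ∧
      S ≤ (1 + (1 - σ) * (σ * θ / (σ * θ - 1))) * Real.exp (c / Real.log θ * Real.log σ) := by
  have hθ0 : 0 < θ := by linarith
  have hσ0 : 0 < σ := pos_of_mul_pos_left (by linarith : 0 < σ * θ) hθ0.le
  have hg := (hasSum_geometric_of_lt_one hσ0.le hσ1).mul_left (1 - σ)
  rw [mul_inv_cancel₀ (by linarith)] at hg
  have hle : ∀ x : ℕ, (1 - σ) * σ ^ x * min 1 (Real.exp (-c) * θ ^ x) ≤ (1 - σ) * σ ^ x :=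
    fun x => mul_le_of_le_one_right (mul_nonneg (by linarith) (by positivity)) (min_le_left _ _)
  have hs : Summable fun x : ℕ => (1 - σ) * σ ^ x * min 1 (Real.exp (-c) * θ ^ x) :=
    Summable.of_nonneg_of_le (fun x => mul_nonneg (mul_nonneg (by linarith) (by positivity))
      (by positivity)) hle hg.summable
  refine ⟨_, hs.hasSum, ?_⟩
  have hlog : 0 < Real.log θ := Real.log_pos hθ
  set s := c / Real.log θ with hsdef
  have hs0 : 0 ≤ s := by positivity
  -- The geometric series is split at the first integer past the crossing point `s`.
  set N := ⌈s⌉₊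
  have hNs : s ≤ N := Nat.le_ceil s
  have hNs1 : (N : ℝ) ≤ s + 1 := (Nat.ceil_lt_add_one hs0).le
  have hpow : ∀ r : ℝ, 0 < r → r ^ N = Real.exp (N * Real.log r) := fun r hr => by
    rw [Real.exp_nat_mul, Real.exp_log hr]
  have htail : σ ^ N ≤ Real.exp (s * Real.log σ) := by
    rw [hpow σ hσ0]
    exact Real.exp_le_exp.mpr (mul_le_mul_of_nonpos_right hNs (Real.log_neg hσ0 hσ1).le)
  have hhead : Real.exp (-c) * (σ * θ) ^ N ≤ σ * θ * Real.exp (s * Real.log σ) := by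
    have h1 : c = s * Real.log θ := by rw [hsdef]; field_simp
    nth_rw 2 [← Real.exp_log (by linarith : 0 < σ * θ)]
    rw [hpow _ (by linarith), ← Real.exp_add, ← Real.exp_add, Real.exp_le_exp]
    have h2 := mul_le_mul_of_nonneg_right hNs1 (Real.log_pos hσθ).le
    rw [Real.log_mul hσ0.ne' hθ0.ne'] at h2 ⊢
    linarith
  rw [← hs.sum_add_tsum_nat_add N]
  have h1 : ∑ x ∈ Finset.range N, (1 - σ) * σ ^ x * min 1 (Real.exp (-c) * θ ^ x) ≤
      (1 - σ) * (σ * θ / (σ * θ - 1)) * Real.exp (s * Real.log σ) := by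
    calc _ ≤ ∑ x ∈ Finset.range N, (1 - σ) * Real.exp (-c) * (σ * θ) ^ x := by
          refine Finset.sum_le_sum fun x _ => ?_
          rw [mul_pow, show (1 - σ) * Real.exp (-c) * (σ ^ x * θ ^ x) =
            (1 - σ) * σ ^ x * (Real.exp (-c) * θ ^ x) by ring]
          exact mul_le_mul_of_nonneg_left (min_le_right _ _)
            (mul_nonneg (by linarith) (by positivity))
      _ = (1 - σ) * (Real.exp (-c) * (σ * θ) ^ N - Real.exp (-c)) / (σ * θ - 1) := by
          rw [← Finset.mul_sum, geom_sum_eq hσθ.ne']; ring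
      _ ≤ (1 - σ) * (σ * θ * Real.exp (s * Real.log σ)) / (σ * θ - 1) := by
          refine div_le_div_of_nonneg_right (mul_le_mul_of_nonneg_left ?_ (by linarith))
            (by linarith)
          linarith [Real.exp_pos (-c)]
      _ = _ := by ring
  have h2 : ∑' x : ℕ, (1 - σ) * σ ^ (x + N) * min 1 (Real.exp (-c) * θ ^ (x + N)) ≤ σ ^ N := by
    have h3 := hg.mul_right (σ ^ N)
    rw [one_mul] at h3
    refine hasSum_le (fun x => ?_) ((summable_nat_add_iff N).mpr hs).hasSum h3
    rw [mul_assoc (1 - σ) (σ ^ x), ← pow_add]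
    exact hle (x + N)
  linarith

theorem mainTheorem4 {Ω : Type*} [MeasurableSpace Ω] (P : Measure Ω) [IsProbabilityMeasure P]
    (lam₀ lam mu : ℝ) (hlam : 0 < lam) (hlam_mu : lam < mu) (hlam₀_mu : lam₀ < mu)
    (hlam₀ : √(lam * mu) < lam₀)
    (π₀ π : Measure ℕ) (hπ₀ : IsMM1Stationary lam₀ mu π₀) (hπ : IsMM1Stationary lam mu π)
    (X : ℝ≥0 → Ω → ℕ) (hX : IsMM1QueueLength P lam mu π₀ X) (t : ℝ≥0) :
    tvDist (P.map (X t)) π ≤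
      mm1Const lam₀ lam mu * Real.exp (-mm1Rate lam₀ lam mu * (t : ℝ)) := by
  have hmu : 0 < mu := hlam.trans hlam_mu
  have hlam₀0 : 0 < lam₀ := (Real.sqrt_nonneg _).trans_lt hlam₀
  have := hπ₀.1
  have := hπ.1
  set θ := √(mu / lam) with hθ
  have hθ1 : 1 < θ := Real.lt_sqrt_of_sq_lt (by rw [one_pow]; exact (one_lt_div hlam).mpr hlam_mu)
  have hsq : θ * θ = mu / lam := Real.mul_self_sqrt (by positivity)
  have hinv : √(lam / mu) = θ⁻¹ := by rw [← inv_div, Real.sqrt_inv]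
  have hsqrt : √(lam * mu) = mu / θ := by
    rw [show lam * mu = mu * mu * (lam / mu) by field_simp, Real.sqrt_mul (by positivity),
      Real.sqrt_mul_self hmu.le, hinv, div_eq_mul_inv]
  have hσθ : 1 < lam₀ / mu * θ := by
    rw [hsqrt, div_lt_iff₀ (by linarith)] at hlam₀
    rw [div_mul_eq_mul_div, one_lt_div hmu]; exact hlam₀
  have hσ1 : lam₀ / mu < 1 := (div_lt_one hmu).mpr hlam₀_mu
  set γ := (√mu - √lam) ^ 2 with hγ
  have hγ0 : 0 ≤ γ := sq_nonneg _
  obtain ⟨S, hS, hSle⟩ := exists_hasSum_geometric_mul_min hσ1 hθ1 hσθ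
    (c := γ * t) (by positivity)
  have hrate : γ * t / Real.log θ * Real.log (lam₀ / mu) = -mm1Rate lam₀ lam mu * t := by
    rw [mm1Rate, ← inv_div lam₀ mu, Real.log_inv]; ring
  rw [hrate] at hSle
  -- The mean of `θ ^ x` under `π`; this is where the summand `1 + √(lam / mu)` comes from.
  have hS' : HasSum (fun x : ℕ => (1 - lam / mu) * (lam / mu) ^ x * (Real.exp (-(γ * t)) * θ ^ x))
      ((1 + θ⁻¹) * Real.exp (-(γ * t))) := by
    have hρ : lam / mu = θ⁻¹ * θ⁻¹ := by rw [← mul_inv, hsq, inv_div]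
    have hinv1 : θ⁻¹ < 1 := inv_lt_one_of_one_lt₀ hθ1
    have h1 := (hasSum_geometric_of_lt_one (inv_nonneg.mpr (by linarith)) hinv1).mul_left
      ((1 - lam / mu) * Real.exp (-(γ * t)))
    have h2 : 1 - θ⁻¹ ≠ 0 := (sub_pos.mpr hinv1).ne'
    have h3 : θ⁻¹ * θ = 1 := inv_mul_cancel₀ (by linarith)
    have h4 : ∀ x : ℕ, (1 - lam / mu) * (lam / mu) ^ x * (Real.exp (-(γ * t)) * θ ^ x) =
        (1 - lam / mu) * Real.exp (-(γ * t)) * θ⁻¹ ^ x := fun x => by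
      calc _ = (1 - lam / mu) * Real.exp (-(γ * t)) * (lam / mu * θ) ^ x := by
            rw [mul_pow]; ring
        _ = _ := by rw [hρ, mul_assoc θ⁻¹, h3, mul_one]
    have h5 : (1 + θ⁻¹) * Real.exp (-(γ * t)) =
        (1 - lam / mu) * Real.exp (-(γ * t)) * (1 - θ⁻¹)⁻¹ := by
      rw [eq_mul_inv_iff_mul_eq₀ h2, hρ]; ring
    simp only [h4]
    rwa [h5]
  -- The rate `mm1Rate` is at most `γ`, because `√(lam * mu) < lam₀`.
  have hexp : Real.exp (-(γ * t)) ≤ Real.exp (-mm1Rate lam₀ lam mu * t) := by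
    have hlog : 0 < Real.log θ := Real.log_pos hθ1
    rw [← hrate, Real.exp_le_exp]
    have h1 : 0 ≤ Real.log (lam₀ / mu) + Real.log θ := by
      rw [← Real.log_mul (by positivity) (by positivity)]; exact (Real.log_pos hσθ).le
    have h2 : γ * t / Real.log θ * Real.log (lam₀ / mu) =
        γ * t / Real.log θ * (Real.log (lam₀ / mu) + Real.log θ) - γ * t := by field_simp; ring
    have : 0 ≤ γ * t / Real.log θ * (Real.log (lam₀ / mu) + Real.log θ) := by positivity
    linarith
  have hconst : mm1Const lam₀ lam mu = 1 + (1 - lam₀ / mu) *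
      (lam₀ / mu * θ / (lam₀ / mu * θ - 1)) + (1 + θ⁻¹) := by
    have h1 : lam₀ * θ - mu ≠ 0 := by
      rw [div_mul_eq_mul_div, one_lt_div hmu] at hσθ; linarith
    have h2 : lam₀ / (lam₀ - mu / θ) = lam₀ / mu * θ / (lam₀ / mu * θ - 1) := by
      have : θ ≠ 0 := by positivity
      rw [show lam₀ - mu / θ = (lam₀ * θ - mu) / θ by field_simp,
        show lam₀ / mu * θ - 1 = (lam₀ * θ - mu) / mu by field_simp]
      field_simp
    rw [mm1Const, hinv, hsqrt, h2]; ring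
  have := hX.measurable t
  refine tvDist_le_of_finset fun A => ?_
  refine (abs_sub_le_of_abs_sub_le_add (p := fun x => π₀.real {x}) (q := fun x => π.real {x})
    (a := fun x => min 1 (Real.exp (-(γ * t)) * θ ^ x))
    (b := fun x => Real.exp (-(γ * t)) * θ ^ x) (fun _ => measureReal_nonneg)
    (fun _ => measureReal_nonneg) (hasSum_real_singleton π₀) (hasSum_real_singleton π)
    (by simpa only [hπ₀.real_singleton hlam₀0.le hlam₀_mu] using hS)
    (by simpa only [hπ.real_singleton hlam.le hlam_mu] using hS')
    (hX.hasSum_real_map t A) (hπ.hasSum_real t A) fun x y => ?_).trans ?_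
  · have h1 := abs_sum_mm1Transition_sub_le_one hlam.le hmu.le t A x y
    have h2 := abs_sum_mm1Transition_sub_le_exp hlam hlam_mu.le t A x y
    rw [← hθ, ← hγ, neg_mul] at h2
    rcases le_total x y with hxy | hxy
    · rw [max_eq_right hxy] at h2
      exact le_add_of_nonneg_of_le (by positivity) h2
    · rw [max_eq_left hxy] at h2
      exact le_add_of_le_of_nonneg (le_min h1 h2) (by positivity)
  · rw [hconst, add_mul _ (1 + θ⁻¹)]
    exact add_le_add hSle (mul_le_mul_of_nonneg_left hexp (by positivity))
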